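/- Let $A\in\mathbb{C}^{n\times n}$ with set of eigenvalues $\sigma(A)\subset\mathbb{C}$ and minimal polynomial $m_A$. For $B\in\mathbb{C}^{n\times n}$ and $\lambda\in\mathbb{C}$ let $\mathcal{L}_\lambda(B)$ be the root subspace of $B$ at $\lambda$, i.e. the zero vector together with all elements of all Jordan chains of $B$ at $\lambda$ (so $\mathcal{L}_\lambda(B)=\{0\}$ if $\lambda\notin\sigma(B)$). For $\lambda\in\sigma(A)$ let $m_1(\lambda)$ be the length of the longest Jordan chain of $A$ at $\lambda$. For $v\in\mathbb{C}^n$ and $\lambda\in\sigma(A)$ let $m_{0,v}(\lambda)$ be the order of $\lambda$ as a pole of $s\mapsto(sI_n-A)^{-1}v$, i.e. the maximal order of $\lambda$ as a pole of one of the entries, with $m_{0,v}(\lambda)=0$ if no entry has a pole at $\lambda$; put $M(A,0,v)=\sum_{\lambda\in\sigma(A)}m_{0,v}(\lambda)$. (1) Fix $v\in\mathbb{C}^n$. For all pairwise distinct $\mu_1,\ldots,\mu_l\in\mathbb{C}$ and all multiplicities $m_1,\ldots,m_l\in\mathbb{N}\setminus\{0\}$ with $\sum_{i=1}^l m_i=M(A,0,v)$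 (so that $l\le M(A,0,v)$; $l=0$ is allowed) there exists $w\in\mathbb{C}^n$ such that $$\sigma(A+vw^*)=\{\mu_1,\ldots,\mu_l\}\cup\{\lambda\in\sigma(A)\mid \dim\ker(\lambda I_n-A)\ge 2\ \text{or}\ m_{0,v}(\lambda)<m_1(\lambda)\}$$ and $$\dim\mathcal{L}_\lambda(A+vw^*)=\begin{cases}\dim\mathcal{L}_\lambda(A)-m_{0,v}(\lambda)+m_i,&\lambda=\mu_i\in\sigma(A),\\ \dim\mathcal{L}_\lambda(A)-m_{0,v}(\lambda),&\lambda\in\sigma(A)\setminus\{\mu_1,\ldots,\mu_l\},\\ m_i,&\lambda=\mu_i\notin\sigma(A),\\ 0,&\lambda\in\mathbb{C}\setminus(\sigma(A)\cup\{\mu_1,\ldots,\mu_l\}).\end{cases}$$ (2) There exists $v\in\mathbb{C}^n$ with $m_{0,v}(\lambda)=m_1(\lambda)$ for all $\lambda\in\sigma(A)$. For every such $v$ one has $M(A,0,v)=\deg m_A$, and for all pairwise distinct $\mu_1,\ldots,\mu_l\in\mathbb{C}$ and multiplicities $m_1,\ldots,m_l\in\mathbb{N}\setminus\{0\}$ with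 $\sum_{i=1}^l m_i=\deg m_A$ there exists $w\in\mathbb{C}^n$ such that $$\sigma(A+vw^*)=\{\mu_1,\ldots,\mu_l\}\cup\{\lambda\in\sigma(A)\mid\dim\ker(\lambda I_n-A)\ge 2\}$$ and the dimension formula of (1) holds. (3) If $A$ is real, then the vector $v$ in the existence statement of (2) can be chosen in $\mathbb{R}^n$. If $A$ and $v$ are real and the prescribed values are symmetric with respect to the real line, with equal multiplicities at complex conjugate values, then $w$ in (1) and in (2) can be chosen in $\mathbb{R}^n$. -/

import Mathlib

/-- `g 0, …, g (k - 1)` is a Jordan chain of length `k ≥ 1` of the pencil `s I - A` at `z`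
(only the first `k` values of `g` matter). -/
def IsJordanChain {n : ℕ} (A : Matrix (Fin n) (Fin n) ℂ) (z : ℂ) (k : ℕ)
    (g : ℕ → Fin n → ℂ) : Prop :=
  0 < k ∧ g 0 ≠ 0 ∧ (A - z • (1 : Matrix (Fin n) (Fin n) ℂ)).mulVec (g 0) = 0 ∧
    ∀ j : ℕ, j + 1 < k →
      (A - z • (1 : Matrix (Fin n) (Fin n) ℂ)).mulVec (g (j + 1)) = g j

/-- The root subspace at `z`: it consists of all elements of all Jordan chains at `z`
(the span only adds the zero vector, which is never a member of a chain). -/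
def rootSubspace {n : ℕ} (A : Matrix (Fin n) (Fin n) ℂ) (z : ℂ) : Submodule ℂ (Fin n → ℂ) :=
  Submodule.span ℂ
    {x | ∃ (k : ℕ) (g : ℕ → Fin n → ℂ) (j : ℕ), IsJordanChain A z k g ∧ j < k ∧ g j = x}

/-- The dimension of the root subspace. -/
noncomputable def rootDim {n : ℕ} (A : Matrix (Fin n) (Fin n) ℂ) (z : ℂ) : ℕ :=
  Module.finrank ℂ (rootSubspace A z)

/-- `m₁(z)`: the length of the longest Jordan chain at `z`
(the set is bounded by `n`, since the members of a chain are linearly independent). -/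
noncomputable def longestChain {n : ℕ} (A : Matrix (Fin n) (Fin n) ℂ) (z : ℂ) : ℕ :=
  sSup {k : ℕ | ∃ g : ℕ → Fin n → ℂ, IsJordanChain A z k g}

/-- `dim ker (z I - A)`. -/
noncomputable def kerDim {n : ℕ} (A : Matrix (Fin n) (Fin n) ℂ) (z : ℂ) : ℕ :=
  Module.finrank ℂ
    (LinearMap.ker (Matrix.toLin' (z • (1 : Matrix (Fin n) (Fin n) ℂ) - A)))

/-- The order of `z` as a pole of the scalar function `f`; it is `0` when there is no pole. -/
noncomputable def poleOrder (f : ℂ → ℂ) (z : ℂ) : ℕ :=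
  (-(meromorphicOrderAt f z).untop₀).toNat

/-- `m_{u,v}(z)`: the order of `z` as a pole of `s ↦ (s I - A)⁻¹ (s u + v)`, that is, the maximal
order of `z` as a pole of one of the entries. -/
noncomputable def resolventPoleOrder {n : ℕ} (A : Matrix (Fin n) (Fin n) ℂ) (u v : Fin n → ℂ)
    (z : ℂ) : ℕ :=
  Finset.univ.sup fun i : Fin n =>
    poleOrder
      (fun s : ℂ => ((s • (1 : Matrix (Fin n) (Fin n) ℂ) - A)⁻¹.mulVec (s • u + v)) i) z

/-- `M(s I - A, u, v)`: the sum of `m_{u,v}(z)` over all eigenvalues `z` of `A`. -/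
noncomputable def totalPoleOrder {n : ℕ} (A : Matrix (Fin n) (Fin n) ℂ) (u v : Fin n → ℂ) : ℕ :=
  ∑ z ∈ (Matrix.finite_spectrum A).toFinset, resolventPoleOrder A u v z

/-- The formula for the dimensions of the root subspaces of `B`, a perturbation of `A`, with
the numbers `m_{u,v}` of `A` and prescribed values `μ i` of multiplicities `m i`. -/
def RootDimFormula {n l : ℕ} (A B : Matrix (Fin n) (Fin n) ℂ) (u v : Fin n → ℂ)
    (μ : Fin l → ℂ) (m : Fin l → ℕ) : Prop :=
  (∀ i, μ i ∈ spectrum ℂ A →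
    (rootDim B (μ i) : ℤ) = rootDim A (μ i) - resolventPoleOrder A u v (μ i) + m i) ∧
  (∀ z, z ∈ spectrum ℂ A → z ∉ Set.range μ →
    (rootDim B z : ℤ) = rootDim A z - resolventPoleOrder A u v z) ∧
  (∀ i, μ i ∉ spectrum ℂ A → rootDim B (μ i) = m i) ∧
  (∀ z, z ∉ spectrum ℂ A → z ∉ Set.range μ → rootDim B z = 0)

/-- The family of values `μ i` with multiplicities `m i` is symmetric with respect to the
real line. -/
def ConjSymmetric {l : ℕ} (μ : Fin l → ℂ) (m : Fin l → ℕ) : Prop :=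
  ∀ i, ∃ j, μ j = star (μ i) ∧ m j = m i

/-- All entries of the vector are real. -/
def IsRealVec {n : ℕ} (v : Fin n → ℂ) : Prop := ∀ i, (v i).im = 0

/-- All entries of the matrix are real. -/
def IsRealMat {n : ℕ} (A : Matrix (Fin n) (Fin n) ℂ) : Prop := ∀ i j, (A i j).im = 0

/-! Let `p` be the monic generator of the ideal of all `q` with `q(A)v = 0`. Then `(s - A)⁻¹ v =
N(s) / p(s)`, where `N` has degree below `deg p` and its `deg p` coefficient vectors are linearly
independent. Hence nothing cancels in `N / p`: the pole order at `z` is the multiplicity of `z` in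
`p`, and these add up to `deg p`. The matrix determinant lemma gives `p * charpoly (A + v aᵀ) =
charpoly A * (p - aᵀN)`. By independence `aᵀN` can be any polynomial of degree below `deg p`, so the
last factor can be any monic `t` of degree `deg p`; take `t = ∏ (X - μ i) ^ m i`
(`exists_mul_charpoly_add_vecMulVec`). The rest compares root multiplicities: `charpoly` gives
`rootDim`, `minpoly` gives `longestChain`, and they differ at an eigenvalue exactly when the
eigenspace has dimension at least 2. A suitable `v` for part (2) has `p = minpoly`; a generic real
vector does. For real data, a solution `a` is averaged with its conjugate. -/

open Polynomial Matrix

/-! ### Annihilating polynomial of a vector and rank-one perturbations -/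

section VecMinpoly

variable {K : Type*} [Field K] {n : ℕ}

/-- `p` is the minimal polynomial of the vector `v` with respect to `A`. -/
def IsVecMinpoly (A : Matrix (Fin n) (Fin n) K) (v : Fin n → K) (p : K[X]) : Prop :=
  p.Monic ∧ aeval A p *ᵥ v = 0 ∧ ∀ q : K[X], aeval A q *ᵥ v = 0 → p ∣ q

lemma exists_isVecMinpoly (A : Matrix (Fin n) (Fin n) K) (v : Fin n → K) :
    ∃ p, IsVecMinpoly A v p := by
  classical
  let I : Ideal K[X] :=
    { carrier := {q | aeval A q *ᵥ v = 0}
      add_mem' := fun {a b} ha hb => by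
        simp only [Set.mem_ofPred_eq] at ha hb ⊢
        simp [Matrix.add_mulVec, ha, hb]
      zero_mem' := by simp
      smul_mem' := fun c x hx => by
        simp only [Set.mem_ofPred_eq] at hx ⊢
        rw [smul_eq_mul, map_mul, ← Matrix.mulVec_mulVec, hx, Matrix.mulVec_zero] }
  have hmem : ∀ q, q ∈ I ↔ aeval A q *ᵥ v = 0 := fun q => Iff.rfl
  have hne : I ≠ ⊥ := by
    intro h
    have : A.charpoly ∈ I := by rw [hmem, Matrix.aeval_self_charpoly, Matrix.zero_mulVec]
    rw [h, Ideal.mem_bot] at this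
    exact A.charpoly_monic.ne_zero this
  obtain ⟨g, hg⟩ := (IsPrincipalIdealRing.principal I).principal
  have hg' : ∀ q, aeval A q *ᵥ v = 0 ↔ g ∣ q := fun q => by
    rw [← hmem, hg]; exact Ideal.mem_span_singleton
  have hg0 : g ≠ 0 := by
    rintro rfl
    exact hne (by rw [hg]; simp)
  refine ⟨normalize g, Polynomial.monic_normalize hg0, ?_, ?_⟩
  · rw [hg']; exact dvd_normalize_iff.2 dvd_rfl
  · intro q hq
    exact normalize_dvd_iff.2 ((hg' q).1 hq)

namespace IsVecMinpoly

variable {A : Matrix (Fin n) (Fin n) K} {v : Fin n → K} {p : K[X]}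

lemma aeval_mulVec_eq_zero_iff (h : IsVecMinpoly A v p) (q : K[X]) :
    aeval A q *ᵥ v = 0 ↔ p ∣ q := by
  refine ⟨h.2.2 q, ?_⟩
  rintro ⟨r, rfl⟩
  rw [mul_comm, map_mul, ← Matrix.mulVec_mulVec, h.2.1, Matrix.mulVec_zero]

lemma dvd_minpoly (h : IsVecMinpoly A v p) : p ∣ minpoly K A :=
  h.2.2 _ (by rw [minpoly.aeval, Matrix.zero_mulVec])

lemma dvd_charpoly (h : IsVecMinpoly A v p) : p ∣ A.charpoly :=
  h.2.2 _ (by rw [Matrix.aeval_self_charpoly, Matrix.zero_mulVec])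

end IsVecMinpoly

lemma coeff_iterate_divX (p : K[X]) (k j : ℕ) : (divX^[k] p).coeff j = p.coeff (j + k) := by
  induction k generalizing j with
  | zero => simp
  | succ k ih => rw [Function.iterate_succ_apply', coeff_divX, ih]; congr 1; ring

/-- The Taylor-like expansion of the numerator `(p(s) - p(X)) / (s - X)`. -/
lemma sub_X_mul_sum_iterate_divX (p : K[X]) (s : K) (M : ℕ) :
    (C s - X) * ∑ k ∈ Finset.range M, C (s ^ k) * divX^[k + 1] p =
      C (s ^ M) * divX^[M] p - p + ∑ k ∈ Finset.range M, C (p.coeff k * s ^ k) := by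
  induction M with
  | zero => simp
  | succ M ih =>
    rw [Finset.sum_range_succ, mul_add, ih, Finset.sum_range_succ]
    have h1 : divX^[M] p = divX^[M + 1] p * X + C (p.coeff M) := by
      conv_lhs => rw [← divX_mul_X_add (divX^[M] p)]
      rw [coeff_iterate_divX, zero_add, Function.iterate_succ_apply']
    rw [h1]
    simp only [C_mul, C_pow]
    ring

/-- The coefficients of the numerator of `(s - A)⁻¹ v` over the denominator `p(s)`. -/
noncomputable def resolventCoeff (A : Matrix (Fin n) (Fin n) K) (v : Fin n → K) (p : K[X])
    (k : ℕ) : Fin n → K :=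
  aeval A (divX^[k + 1] p) *ᵥ v

namespace IsVecMinpoly

variable {A : Matrix (Fin n) (Fin n) K} {v : Fin n → K} {p : K[X]}

/-- This is `(s - X) * N = p(s) - p(X)` evaluated at `A` and applied to `v`, where `p(A)v = 0`.
Being free of inverses, it also holds at eigenvalues. -/
lemma sub_mulVec_sum_resolventCoeff (h : IsVecMinpoly A v p) (s : K) :
    (s • (1 : Matrix (Fin n) (Fin n) K) - A) *ᵥ
      (∑ k ∈ Finset.range p.natDegree, s ^ k • resolventCoeff A v p k) = p.eval s • v := by
  have h0 := sub_X_mul_sum_iterate_divX p s p.natDegree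
  have h1 : divX^[p.natDegree] p = C (p.coeff p.natDegree) := by
    ext j
    rw [coeff_iterate_divX, coeff_C]
    split_ifs with hj
    · simp [hj]
    · exact coeff_eq_zero_of_natDegree_lt (by omega)
  have h2 : C (s ^ p.natDegree) * divX^[p.natDegree] p - p +
      ∑ k ∈ Finset.range p.natDegree, C (p.coeff k * s ^ k) = C (p.eval s) - p := by
    rw [eval_eq_sum_range, Finset.sum_range_succ, h1, map_add, map_sum, ← C_mul]
    rw [mul_comm]; ring
  rw [h2] at h0
  have h3 := congrArg (fun q => aeval A q *ᵥ v) h0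
  simp only [map_mul, map_sub, ← Matrix.mulVec_mulVec, map_sum, Matrix.sub_mulVec, h.2.1] at h3
  simp only [aeval_C, aeval_X, Algebra.algebraMap_eq_smul_one] at h3
  rw [Matrix.sub_mulVec]
  convert h3 using 2
  · simp only [resolventCoeff, Matrix.sum_mulVec, smul_mul_assoc, one_mul, Matrix.smul_mulVec]
  · simp only [resolventCoeff, Matrix.sum_mulVec, smul_mul_assoc, one_mul, Matrix.smul_mulVec]
  · simp [Matrix.smul_mulVec]

/-- A vanishing combination is `q(A)v = 0` with `deg q < deg p`, so `q = 0`; the coefficients of `q`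
are triangular in the `c k`. -/
lemma linearIndependent_resolventCoeff (h : IsVecMinpoly A v p) :
    LinearIndependent K (fun k : Fin p.natDegree => resolventCoeff A v p k) := by
  rw [Fintype.linearIndependent_iff]
  intro c hc
  set q : K[X] := ∑ k : Fin p.natDegree, C (c k) * divX^[(k : ℕ) + 1] p with hq
  have hcoeff : ∀ j, q.coeff j = ∑ k : Fin p.natDegree, c k * p.coeff (j + (k + 1)) := fun j => by
    rw [hq, finsetSum_coeff]
    exact Finset.sum_congr rfl fun k _ => by rw [coeff_C_mul, coeff_iterate_divX]
  have hq0 : q = 0 := by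
    refine eq_zero_of_dvd_of_degree_lt (h.2.2 q ?_) ?_
    · rw [← hc, hq, map_sum, Matrix.sum_mulVec]
      refine Finset.sum_congr rfl fun k _ => ?_
      rw [map_mul, aeval_C, Algebra.algebraMap_eq_smul_one, smul_mul_assoc, one_mul,
        Matrix.smul_mulVec]
      rfl
    · rw [degree_eq_natDegree h.1.ne_zero, degree_lt_iff_coeff_zero]
      intro j hj
      rw [hcoeff]
      refine Finset.sum_eq_zero fun k _ => ?_
      rw [coeff_eq_zero_of_natDegree_lt (by omega), mul_zero]
  have key : ∀ (m : ℕ) (hm : m < p.natDegree), c ⟨m, hm⟩ = 0 := by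
    intro m
    induction m using Nat.strong_induction_on with
    | _ m ih =>
      intro hm
      -- In this coefficient `c m` meets the leading coefficient 1 of `p`; larger indices exceed the
      -- degree, smaller ones vanish by induction.
      have h1 := hcoeff (p.natDegree - 1 - m)
      rw [hq0, coeff_zero, Finset.sum_eq_single ⟨m, hm⟩] at h1
      · have : p.natDegree - 1 - m + (m + 1) = p.natDegree := by omega
        simp only [this, h.1.coeff_natDegree, mul_one] at h1
        exact h1.symm
      · intro b _ hb
        rcases lt_trichotomy (b : ℕ) m with hbm | hbm | hbm
        · rw [ih b hbm b.2, zero_mul]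
        · exact absurd (Fin.ext hbm) hb
        · rw [coeff_eq_zero_of_natDegree_lt (by omega), mul_zero]
      · simp
  exact fun i => key i i.2

end IsVecMinpoly

lemma det_sub_vecMulVec {M : Matrix (Fin n) (Fin n) K} (hM : M.det ≠ 0) (v a : Fin n → K) :
    (M - vecMulVec v a).det = M.det - a ⬝ᵥ (M.adjugate *ᵥ v) := by
  have h := det_add_mul (replicateCol Unit (-v)) (replicateRow Unit a) hM.isUnit
  rw [← vecMulVec_eq, neg_vecMulVec, ← sub_eq_add_neg] at h
  rw [h, det_unique (n := Unit), Matrix.add_apply, Matrix.one_apply_eq, Matrix.mul_assoc,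
    ← replicateCol_mulVec, replicateRow_mul_replicateCol_apply, Matrix.inv_def,
    Matrix.smul_mulVec, mulVec_neg, smul_neg, dotProduct_neg, dotProduct_smul, smul_eq_mul,
    Ring.inverse_eq_inv]
  field_simp
  ring

namespace IsVecMinpoly

variable {A : Matrix (Fin n) (Fin n) K} {v : Fin n → K} {p : K[X]}

lemma mul_charpoly_add_vecMulVec [Infinite K] (h : IsVecMinpoly A v p) (a : Fin n → K) :
    p * (A + vecMulVec v a).charpoly =
      A.charpoly * (p - ∑ k ∈ Finset.range p.natDegree,
        C (a ⬝ᵥ resolventCoeff A v p k) * X ^ k) := by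
  -- The extra factor `A.charpoly` makes the identity trivial at eigenvalues, so `s - A` may be
  -- assumed invertible.
  refine mul_right_cancel₀ A.charpoly_monic.ne_zero (Polynomial.funext fun s => ?_)
  rw [eval_mul, eval_mul (q := A.charpoly)]
  rcases eq_or_ne (A.charpoly.eval s) 0 with h0 | h0
  · rw [h0, mul_zero, mul_zero]
  congr 1
  set N : Fin n → K := ∑ k ∈ Finset.range p.natDegree, s ^ k • resolventCoeff A v p k with hN
  set M : Matrix (Fin n) (Fin n) K := s • (1 : Matrix (Fin n) (Fin n) K) - A with hM
  have hsc : Matrix.scalar (Fin n) s = s • (1 : Matrix (Fin n) (Fin n) K) := by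
    rw [Matrix.scalar_apply, Matrix.smul_one_eq_diagonal]
  have hdet : p.eval s • (M.adjugate *ᵥ v) = M.det • N := by
    rw [← Matrix.mulVec_smul, ← h.sub_mulVec_sum_resolventCoeff s, Matrix.mulVec_mulVec,
      Matrix.adjugate_mul, Matrix.smul_mulVec, Matrix.one_mulVec]
  have hsum : eval s (∑ k ∈ Finset.range p.natDegree,
      C (a ⬝ᵥ resolventCoeff A v p k) * X ^ k) = a ⬝ᵥ N := by
    rw [hN, eval_finsetSum, dotProduct_sum]
    exact Finset.sum_congr rfl fun k _ => by
      simp only [eval_mul, eval_C, eval_pow, eval_X, dotProduct_smul, smul_eq_mul, mul_comm]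
  rw [Matrix.eval_charpoly, hsc, ← hM] at h0
  rw [eval_mul, eval_mul, eval_sub, hsum, Matrix.eval_charpoly, Matrix.eval_charpoly, hsc,
    ← sub_sub, ← hM, det_sub_vecMulVec h0, mul_sub, mul_sub]
  have := congrArg (fun x => a ⬝ᵥ x) hdet
  simp only [dotProduct_smul, smul_eq_mul] at this
  linear_combination -this

/-- Any monic polynomial of the right degree can replace the factor `p` of `A.charpoly` by a
rank-one perturbation with first factor `v`. -/
lemma exists_mul_charpoly_add_vecMulVec [Infinite K] (h : IsVecMinpoly A v p) {t : K[X]}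
    (ht : t.Monic) (hd : t.natDegree = p.natDegree) :
    ∃ a, p * (A + vecMulVec v a).charpoly = A.charpoly * t := by
  have hli := h.linearIndependent_resolventCoeff
  -- Independence allows a functional `f` with prescribed values on the `resolventCoeff`; `a` is its
  -- coordinate vector.
  obtain ⟨g, hg⟩ := LinearMap.exists_leftInverse_of_injective
    (Fintype.linearCombination K fun k : Fin p.natDegree => resolventCoeff A v p k)
    (LinearMap.ker_eq_bot.2 hli.fintypeLinearCombination_injective)
  let f : (Fin n → K) →ₗ[K] K :=
    (Fintype.linearCombination K fun k : Fin p.natDegree => (p - t).coeff k) ∘ₗ g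
  have hf : ∀ k : Fin p.natDegree, f (resolventCoeff A v p k) = (p - t).coeff k := fun k => by
    have h1 := LinearMap.congr_fun hg (Pi.single k 1)
    simp only [LinearMap.comp_apply, Fintype.linearCombination_apply_single, one_smul,
      LinearMap.id_apply] at h1
    simp only [f, LinearMap.comp_apply, h1, Fintype.linearCombination_apply_single, one_smul]
  refine ⟨fun i => f (Pi.single i 1), ?_⟩
  have hfa : ∀ x, (fun i => f (Pi.single i 1)) ⬝ᵥ x = f x := fun x => by
    conv_rhs => rw [LinearMap.pi_apply_eq_sum_univ f x]
    simp only [dotProduct, smul_eq_mul]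
    exact Finset.sum_congr rfl fun i _ => by
      rw [mul_comm]; congr 2; ext j; simp [Pi.single_apply, eq_comm]
  rw [h.mul_charpoly_add_vecMulVec]
  congr 1
  rw [sub_eq_iff_eq_add', ← sub_eq_iff_eq_add]
  have hdeg : (p - t).degree < (p.natDegree : WithBot ℕ) := by
    rw [← degree_eq_natDegree h.1.ne_zero]
    refine degree_sub_lt_left ?_ h.1.ne_zero (by rw [h.1.leadingCoeff, ht.leadingCoeff])
    rw [degree_eq_natDegree h.1.ne_zero, degree_eq_natDegree ht.ne_zero, hd]
  ext j
  rw [finsetSum_coeff]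
  simp only [coeff_C_mul, coeff_X_pow, mul_ite, mul_one, mul_zero]
  rw [Finset.sum_ite_eq]
  split_ifs with hj
  · rw [hfa, hf ⟨j, Finset.mem_range.1 hj⟩]
  · exact (degree_lt_iff_coeff_zero _ _).1 hdeg j (by simpa using hj)

end IsVecMinpoly

end VecMinpoly

/-! ### Pole orders of the resolvent -/

section Pole

variable {n : ℕ} {A : Matrix (Fin n) (Fin n) ℂ} {v : Fin n → ℂ} {p : ℂ[X]}

lemma meromorphicOrderAt_eval {a : ℂ[X]} (ha : a ≠ 0) (z : ℂ) :
    meromorphicOrderAt (fun s => a.eval s) z = (a.rootMultiplicity z : ℤ) := by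
  have han : AnalyticAt ℂ (fun s => a.eval s) z :=
    (AnalyticOnNhd.eval_polynomial a) z (Set.mem_univ z)
  rw [meromorphicOrderAt_eq_int_iff han.meromorphicAt]
  obtain ⟨q, hq, hq'⟩ := exists_eq_pow_rootMultiplicity_mul_and_not_dvd a ha z
  refine ⟨fun s => q.eval s, (AnalyticOnNhd.eval_polynomial q) z (Set.mem_univ z), ?_, ?_⟩
  · rwa [dvd_iff_isRoot, IsRoot.def] at hq'
  · refine Filter.Eventually.of_forall fun s => ?_
    conv_lhs => rw [hq]
    simp

lemma poleOrder_zero (z : ℂ) : poleOrder (fun _ => 0) z = 0 := by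
  simp [poleOrder, meromorphicOrderAt_const]

lemma poleOrder_eval_div_eval {a b : ℂ[X]} (ha : a ≠ 0) (hb : b ≠ 0) (z : ℂ) :
    poleOrder (fun s => a.eval s / b.eval s) z =
      b.rootMultiplicity z - a.rootMultiplicity z := by
  have hm : ∀ q : ℂ[X], MeromorphicAt (fun s => q.eval s) z := fun q =>
    ((AnalyticOnNhd.eval_polynomial q) z (Set.mem_univ z)).meromorphicAt
  rw [poleOrder, fun_meromorphicOrderAt_div (hm a) (hm b), meromorphicOrderAt_eval ha,
    meromorphicOrderAt_eval hb]
  have : ((a.rootMultiplicity z : ℤ) : WithTop ℤ) - ((b.rootMultiplicity z : ℤ) : WithTop ℤ) =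
      (((a.rootMultiplicity z : ℤ) - (b.rootMultiplicity z : ℤ) : ℤ) : WithTop ℤ) := rfl
  rw [this, WithTop.untop₀_coe]
  omega

lemma poleOrder_congr {f g : ℂ → ℂ} {z : ℂ} (h : f =ᶠ[nhdsWithin z {z}ᶜ] g) :
    poleOrder f z = poleOrder g z := by
  rw [poleOrder, poleOrder, meromorphicOrderAt_congr h]

lemma eventually_eval_ne_zero {a : ℂ[X]} (ha : a ≠ 0) (z : ℂ) :
    ∀ᶠ s in nhdsWithin z {z}ᶜ, a.eval s ≠ 0 := by
  have hfin : ({s | a.IsRoot s} \ {z}).Finite := (finite_setOfPred_isRoot ha).sdiff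
  filter_upwards [nhdsWithin_le_nhds (hfin.isClosed.isOpen_compl.mem_nhds (by simp)),
    self_mem_nhdsWithin] with s hs hs' h0
  exact hs ⟨h0, hs'⟩

namespace IsVecMinpoly

/-- Every entry is `N i / p`, which bounds the order above. Equality holds because `N(z) ≠ 0`. -/
lemma resolventPoleOrder_eq (h : IsVecMinpoly A v p) (z : ℂ) :
    resolventPoleOrder A 0 v z = p.rootMultiplicity z := by
  set N : Fin n → ℂ[X] := fun i =>
    ∑ k ∈ Finset.range p.natDegree, C (resolventCoeff A v p k i) * X ^ k with hN
  have hNe : ∀ s, (fun i => (N i).eval s) =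
      ∑ k ∈ Finset.range p.natDegree, s ^ k • resolventCoeff A v p k := fun s => by
    ext i
    simp only [hN, eval_finsetSum, eval_mul, eval_C, eval_pow, eval_X, Finset.sum_apply,
      Pi.smul_apply, smul_eq_mul, mul_comm]
  have hentry : ∀ i, poleOrder
      (fun s : ℂ => ((s • (1 : Matrix (Fin n) (Fin n) ℂ) - A)⁻¹.mulVec
        (s • (0 : Fin n → ℂ) + v)) i) z =
      poleOrder (fun s => (N i).eval s / p.eval s) z := fun i => by
    refine poleOrder_congr ?_
    filter_upwards [eventually_eval_ne_zero h.1.ne_zero z,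
      eventually_eval_ne_zero A.charpoly_monic.ne_zero z] with s hs hc
    rw [Matrix.eval_charpoly, Matrix.scalar_apply, ← Matrix.smul_one_eq_diagonal] at hc
    have h1 := h.sub_mulVec_sum_resolventCoeff s
    rw [← hNe] at h1
    have h2 := congrArg
      (fun x => (s • (1 : Matrix (Fin n) (Fin n) ℂ) - A)⁻¹ *ᵥ x) h1
    simp only [Matrix.mulVec_mulVec, Matrix.nonsing_inv_mul _ hc.isUnit, Matrix.one_mulVec,
      Matrix.mulVec_smul] at h2
    have h3 := congrFun h2 i
    rw [smul_zero, zero_add, eq_div_iff hs]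
    simpa [mul_comm] using h3.symm
  rw [resolventPoleOrder]
  simp only [hentry]
  refine le_antisymm (Finset.sup_le fun i _ => ?_) ?_
  · by_cases hi : N i = 0
    · simp [hi, poleOrder_zero]
    · rw [poleOrder_eval_div_eval hi h.1.ne_zero]; omega
  · rcases Nat.eq_zero_or_pos (p.rootMultiplicity z) with h0 | h0
    · rw [h0]; exact Nat.zero_le _
    · obtain ⟨i, hi⟩ : ∃ i, (N i).eval z ≠ 0 := by
        by_contra! hcon
        have hdeg : 0 < p.natDegree := by
          replace h0 := (rootMultiplicity_pos h.1.ne_zero).1 h0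
          exact natDegree_pos_iff_degree_pos.2 (degree_pos_of_root h.1.ne_zero h0)
        have h4 := hNe z
        rw [funext hcon, ← Fin.sum_univ_eq_sum_range
          (fun k => z ^ k • resolventCoeff A v p k)] at h4
        -- `N(z) = 0` would be a linear relation whose coefficient at index 0 is `z ^ 0 = 1`.
        have h5 := Fintype.linearIndependent_iff.1 h.linearIndependent_resolventCoeff
          (fun k => z ^ (k : ℕ)) h4.symm ⟨0, hdeg⟩
        simp at h5
      have hi0 : N i ≠ 0 := by rintro h; simp [h] at hi
      refine le_trans ?_ (Finset.le_sup (Finset.mem_univ i))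
      rw [poleOrder_eval_div_eval hi0 h.1.ne_zero, rootMultiplicity_eq_zero hi, Nat.sub_zero]

end IsVecMinpoly

end Pole

/-! ### Jordan chains, root subspaces and the minimal polynomial -/

section Chains

variable {n : ℕ} {A : Matrix (Fin n) (Fin n) ℂ} {z : ℂ}

lemma IsJordanChain.pow_mulVec {k : ℕ} {g : ℕ → Fin n → ℂ} (h : IsJordanChain A z k g)
    (j i : ℕ) (hj : i + j < k) :
    ((A - z • (1 : Matrix (Fin n) (Fin n) ℂ)) ^ i) *ᵥ g (i + j) = g j := by
  induction i with
  | zero => simp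
  | succ i ih =>
    rw [pow_succ, ← Matrix.mulVec_mulVec, show i + 1 + j = i + j + 1 by ring,
      h.2.2.2 (i + j) (by omega), ih (by omega)]

lemma IsJordanChain.pow_succ_mulVec {k : ℕ} {g : ℕ → Fin n → ℂ} (h : IsJordanChain A z k g)
    (i : ℕ) (hi : i < k) :
    ((A - z • (1 : Matrix (Fin n) (Fin n) ℂ)) ^ (i + 1)) *ᵥ g i = 0 := by
  have := h.pow_mulVec 0 i (by omega)
  rw [add_zero] at this
  rw [pow_succ', ← Matrix.mulVec_mulVec, this, h.2.2.1]

lemma isJordanChain_of_pow {k : ℕ} {x : Fin n → ℂ}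
    (hx : ((A - z • (1 : Matrix (Fin n) (Fin n) ℂ)) ^ (k + 1)) *ᵥ x = 0)
    (hx' : ((A - z • (1 : Matrix (Fin n) (Fin n) ℂ)) ^ k) *ᵥ x ≠ 0) :
    IsJordanChain A z (k + 1)
      (fun j => ((A - z • (1 : Matrix (Fin n) (Fin n) ℂ)) ^ (k - j)) *ᵥ x) := by
  refine ⟨Nat.succ_pos k, by simpa using hx', ?_, fun j hj => ?_⟩
  · rw [Matrix.mulVec_mulVec, ← pow_succ', Nat.sub_zero, hx]
  · simp only
    rw [Matrix.mulVec_mulVec, ← pow_succ', show k - (j + 1) + 1 = k - j by omega]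

lemma toLin'_sub_smul_pow_apply (k : ℕ) (x : Fin n → ℂ) :
    ((Matrix.toLin' A - z • (1 : Module.End ℂ (Fin n → ℂ))) ^ k) x =
      ((A - z • (1 : Matrix (Fin n) (Fin n) ℂ)) ^ k) *ᵥ x := by
  rw [← Matrix.toLin'_apply, Matrix.toLin'_pow]
  congr 2
  rw [map_sub, map_smul, Matrix.toLin'_one]
  rfl

variable (A z)

lemma rootSubspace_eq_maxGenEigenspace :
    rootSubspace A z = Module.End.maxGenEigenspace (Matrix.toLin' A) z := by
  refine le_antisymm (Submodule.span_le.2 ?_) fun x hx => ?_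
  · rintro x ⟨k, g, j, hg, hj, rfl⟩
    rw [SetLike.mem_coe, Module.End.mem_maxGenEigenspace]
    exact ⟨j + 1, by rw [toLin'_sub_smul_pow_apply, hg.pow_succ_mulVec j hj]⟩
  · rw [Module.End.mem_maxGenEigenspace] at hx
    simp only [toLin'_sub_smul_pow_apply] at hx
    by_cases hx0 : x = 0
    · rw [hx0]; exact zero_mem _
    classical
    have hpos : Nat.find hx ≠ 0 := fun h => hx0 (by simpa [h] using Nat.find_spec hx)
    obtain ⟨k, hk⟩ := Nat.exists_eq_succ_of_ne_zero hpos
    refine Submodule.subset_span ⟨k + 1, _, k, isJordanChain_of_pow (x := x) ?_ ?_,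
      Nat.lt_succ_self k, by simp⟩
    · rw [← Nat.succ_eq_add_one, ← hk]; exact Nat.find_spec hx
    · exact Nat.find_min hx (by omega)

lemma rootDim_eq_rootMultiplicity : rootDim A z = A.charpoly.rootMultiplicity z := by
  rw [rootDim, rootSubspace_eq_maxGenEigenspace, LinearMap.finrank_maxGenEigenspace_eq,
    Matrix.charpoly_toLin']

lemma aeval_X_sub_C_pow (k : ℕ) :
    aeval A ((X - C z) ^ k) = (A - z • (1 : Matrix (Fin n) (Fin n) ℂ)) ^ k := by
  rw [map_pow, map_sub, aeval_X, aeval_C, Algebra.algebraMap_eq_smul_one]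

/-- The annihilating polynomial of `x` divides both `(X - z) ^ k` and `minpoly`, so it is a power of
`X - z` with exponent at most the multiplicity of `z`. -/
lemma pow_rootMultiplicity_mulVec_eq_zero {k : ℕ} {x : Fin n → ℂ}
    (hx : ((A - z • (1 : Matrix (Fin n) (Fin n) ℂ)) ^ k) *ᵥ x = 0) :
    ((A - z • (1 : Matrix (Fin n) (Fin n) ℂ)) ^ (minpoly ℂ A).rootMultiplicity z) *ᵥ x = 0 := by
  obtain ⟨q, hq⟩ := exists_isVecMinpoly A x
  have hm : minpoly ℂ A ≠ 0 := minpoly.ne_zero (Matrix.isIntegral A)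
  have h1 : q ∣ (X - C z) ^ k := hq.2.2 _ (by rw [aeval_X_sub_C_pow, hx])
  obtain ⟨i, -, hi⟩ := (dvd_prime_pow (prime_X_sub_C z) k).1 h1
  rw [← aeval_X_sub_C_pow, hq.aeval_mulVec_eq_zero_iff]
  refine hi.dvd.trans (pow_dvd_pow _ ((le_rootMultiplicity_iff hm).2 ?_))
  exact hi.symm.dvd.trans hq.dvd_minpoly

/-- Write `minpoly = (X - z) ^ (k + 1) * q`. By minimality `(X - z) ^ k * q` does not annihilate
`A`; take `x = q(A) y` for a `y` witnessing this. -/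
lemma exists_pow_mulVec_eq_zero_and_ne_zero {k : ℕ}
    (hk : (minpoly ℂ A).rootMultiplicity z = k + 1) :
    ∃ x, ((A - z • (1 : Matrix (Fin n) (Fin n) ℂ)) ^ (k + 1)) *ᵥ x = 0 ∧
      ((A - z • (1 : Matrix (Fin n) (Fin n) ℂ)) ^ k) *ᵥ x ≠ 0 := by
  have hm : minpoly ℂ A ≠ 0 := minpoly.ne_zero (Matrix.isIntegral A)
  obtain ⟨q, hq, -⟩ := exists_eq_pow_rootMultiplicity_mul_and_not_dvd _ hm z
  rw [hk] at hq
  have hne : aeval A ((X - C z) ^ k * q) ≠ 0 := fun h => by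
    have h1 := minpoly.dvd ℂ A h
    rw [hq, pow_succ', mul_assoc] at h1
    have hne : (X - C z) ^ k * q ≠ 0 := by
      rintro h; rw [pow_succ', mul_assoc, h, mul_zero] at hq; exact hm hq
    have h2 : (X - C z) * ((X - C z) ^ k * q) ∣ 1 * ((X - C z) ^ k * q) := by rwa [one_mul]
    exact (prime_X_sub_C z).not_isUnit (isUnit_of_dvd_one ((mul_dvd_mul_iff_right hne).1 h2))
  obtain ⟨y, hy⟩ : ∃ y, aeval A ((X - C z) ^ k * q) *ᵥ y ≠ 0 := by
    by_contra! hcon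
    exact hne (Matrix.toLin'.injective (LinearMap.ext fun y => by
      rw [Matrix.toLin'_apply, hcon y, map_zero, LinearMap.zero_apply]))
  refine ⟨aeval A q *ᵥ y, ?_, ?_⟩
  · rw [Matrix.mulVec_mulVec, ← aeval_X_sub_C_pow, ← map_mul, ← hq, minpoly.aeval,
      Matrix.zero_mulVec]
  · rwa [Matrix.mulVec_mulVec, ← aeval_X_sub_C_pow, ← map_mul]

lemma longestChain_eq_rootMultiplicity :
    longestChain A z = (minpoly ℂ A).rootMultiplicity z := by
  set r := (minpoly ℂ A).rootMultiplicity z with hr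
  have hub : ∀ k ∈ {k : ℕ | ∃ g : ℕ → Fin n → ℂ, IsJordanChain A z k g}, k ≤ r := by
    rintro k ⟨g, hg⟩
    by_contra! hk
    have h1 := hg.pow_succ_mulVec (k - 1) (by omega)
    have h2 := pow_rootMultiplicity_mulVec_eq_zero A z h1
    -- If `k > r`, then `(A - z) ^ r` already kills the last chain member, hence `g 0 = 0`.
    have h3 := hg.pow_mulVec (k - 1 - r) r (by omega)
    rw [show r + (k - 1 - r) = k - 1 by omega, h2] at h3
    have h4 := hg.pow_mulVec 0 (k - 1 - r) (by omega)
    rw [add_zero, ← h3, Matrix.mulVec_zero] at h4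
    exact hg.2.1 h4.symm
  refine le_antisymm (csSup_le' hub) ?_
  rcases Nat.eq_zero_or_pos r with h0 | h0
  · rw [h0]; exact Nat.zero_le _
  refine le_csSup ⟨r, hub⟩ ?_
  obtain ⟨k, hk⟩ : ∃ k, r = k + 1 := ⟨r - 1, by omega⟩
  obtain ⟨x, hx, hx'⟩ := exists_pow_mulVec_eq_zero_and_ne_zero A z (hr ▸ hk)
  rw [hk]
  exact ⟨_, isJordanChain_of_pow hx hx'⟩

end Chains

/-! ### Dimensions of kernels of powers -/

section KernelGrowth

open Module

variable {K V : Type*} [Field K] [AddCommGroup V] [Module K V] [FiniteDimensional K V]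

/-- Rank-nullity for `g` restricted to a map `ker (f * g) → ker f`. -/
lemma finrank_ker_mul_le (f g : End K V) :
    finrank K (LinearMap.ker (f * g)) ≤
      finrank K (LinearMap.ker f) + finrank K (LinearMap.ker g) := by
  let h : LinearMap.ker (f * g) →ₗ[K] LinearMap.ker f :=
    g.restrict (fun x hx => by simpa using hx)
  have h1 := LinearMap.finrank_range_add_finrank_ker h
  have h2 : finrank K (LinearMap.range h) ≤ finrank K (LinearMap.ker f) :=
    Submodule.finrank_le _
  have h3 : finrank K (LinearMap.ker h) ≤ finrank K (LinearMap.ker g) := by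
    rw [← Submodule.finrank_map_subtype_eq]
    refine Submodule.finrank_mono ?_
    rintro _ ⟨x, hx, rfl⟩
    exact congrArg Subtype.val (LinearMap.mem_ker.1 hx)
  omega

lemma finrank_ker_pow_le (f : End K V) (k : ℕ) :
    finrank K (LinearMap.ker (f ^ k)) ≤ k * finrank K (LinearMap.ker f) := by
  induction k with
  | zero => simp [Module.End.one_eq_id]
  | succ k ih =>
    rw [pow_succ, add_mul, one_mul]
    exact (finrank_ker_mul_le _ _).trans (by omega)

/-- As long as the kernels of the powers have not become stationary, their dimensions grow. -/
lemma finrank_ker_add_le_finrank_ker_pow (f : End K V) {r : ℕ}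
    (hr : LinearMap.ker (f ^ (r + 1)) ≠ LinearMap.ker (f ^ r)) :
    ∀ k ≤ r, finrank K (LinearMap.ker f) + k ≤ finrank K (LinearMap.ker (f ^ (k + 1))) := by
  intro k
  induction k with
  | zero => intro _; rw [zero_add, pow_one, add_zero]
  | succ k ih =>
    intro hk
    have hle : LinearMap.ker (f ^ (k + 1)) ≤ LinearMap.ker (f ^ (k + 1 + 1)) := by
      rw [pow_succ' f (k + 1)]; exact LinearMap.ker_le_ker_comp _ _
    have hlt : LinearMap.ker (f ^ (k + 1)) < LinearMap.ker (f ^ (k + 1 + 1)) := by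
      refine lt_of_le_of_ne hle fun h => hr ?_
      have h1 := Module.End.ker_pow_constant h (r - (k + 1))
      have h2 := Module.End.ker_pow_constant h (r + 1 - (k + 1))
      rw [show k + 1 + (r - (k + 1)) = r by omega] at h1
      rw [show k + 1 + (r + 1 - (k + 1)) = r + 1 by omega] at h2
      rw [← h1, ← h2]
    have := Submodule.finrank_lt_finrank_of_lt hlt
    have := ih (by omega)
    omega

end KernelGrowth

/-! ### Eigenspace dimension against the two multiplicities -/

section KerDim

variable {n : ℕ} (A : Matrix (Fin n) (Fin n) ℂ) (z : ℂ)

lemma kerDim_eq : kerDim A z = Module.finrank ℂ (LinearMap.ker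
    (Matrix.toLin' A - z • (1 : Module.End ℂ (Fin n → ℂ)))) := by
  rw [kerDim]
  have : Matrix.toLin' (z • (1 : Matrix (Fin n) (Fin n) ℂ) - A) =
      -(Matrix.toLin' A - z • (1 : Module.End ℂ (Fin n → ℂ))) := by
    rw [map_sub, map_smul, Matrix.toLin'_one, neg_sub]; rfl
  rw [this, LinearMap.ker_neg]

lemma finrank_ker_pow_rootMultiplicity_minpoly : Module.finrank ℂ (LinearMap.ker
    ((Matrix.toLin' A - z • (1 : Module.End ℂ (Fin n → ℂ))) ^
      (minpoly ℂ A).rootMultiplicity z)) = A.charpoly.rootMultiplicity z := by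
  rw [← rootDim_eq_rootMultiplicity, rootDim, rootSubspace_eq_maxGenEigenspace]
  refine congrArg (fun W : Submodule ℂ (Fin n → ℂ) => Module.finrank ℂ W)
    (Submodule.ext fun x => ?_)
  rw [LinearMap.mem_ker, Module.End.mem_maxGenEigenspace]
  refine ⟨fun h => ⟨_, h⟩, ?_⟩
  rintro ⟨k, hk⟩
  rw [toLin'_sub_smul_pow_apply] at hk ⊢
  exact pow_rootMultiplicity_mulVec_eq_zero A z hk

variable {A z}

lemma rootMultiplicity_minpoly_le :
    (minpoly ℂ A).rootMultiplicity z ≤ A.charpoly.rootMultiplicity z :=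
  rootMultiplicity_le_rootMultiplicity_of_dvd A.charpoly_monic.ne_zero
    (Matrix.minpoly_dvd_charpoly A) z

lemma rootMultiplicity_minpoly_pos (hz : z ∈ spectrum ℂ A) :
    0 < (minpoly ℂ A).rootMultiplicity z := by
  rw [rootMultiplicity_pos (minpoly.ne_zero (Matrix.isIntegral A))]
  have h : z ∈ spectrum ℂ (Matrix.toLin' A) := by rwa [Matrix.spectrum_toLin']
  rw [← Matrix.minpoly_toLin']
  exact Module.End.isRoot_of_hasEigenvalue (Module.End.hasEigenvalue_iff_mem_spectrum.2 h)

/-- Let `ρ` and `α` be the multiplicities in `minpoly` and `charpoly`, and `d` the eigenspace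
dimension. Then `d + ρ - 1 ≤ α ≤ ρ * d`: the kernels grow strictly up to exponent `ρ`, and each
factor adds at most `d`. -/
lemma two_le_kerDim_iff (hz : z ∈ spectrum ℂ A) :
    2 ≤ kerDim A z ↔ (minpoly ℂ A).rootMultiplicity z < A.charpoly.rootMultiplicity z := by
  have hpos := rootMultiplicity_minpoly_pos hz
  have hle : (minpoly ℂ A).rootMultiplicity z ≤ A.charpoly.rootMultiplicity z :=
    rootMultiplicity_minpoly_le
  have hfin := finrank_ker_pow_rootMultiplicity_minpoly A z
  rw [kerDim_eq]
  set f := Matrix.toLin' A - z • (1 : Module.End ℂ (Fin n → ℂ)) with hf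
  obtain ⟨r, hr⟩ : ∃ r, (minpoly ℂ A).rootMultiplicity z = r + 1 :=
    ⟨(minpoly ℂ A).rootMultiplicity z - 1, by omega⟩
  constructor
  · intro h2
    have hne : LinearMap.ker (f ^ (r + 1)) ≠ LinearMap.ker (f ^ r) := by
      obtain ⟨x, hx, hx'⟩ := exists_pow_mulVec_eq_zero_and_ne_zero A z hr
      rw [← toLin'_sub_smul_pow_apply, ← hf] at hx hx'
      exact fun h => hx' (LinearMap.mem_ker.1 (h ▸ LinearMap.mem_ker.2 hx))
    have := finrank_ker_add_le_finrank_ker_pow f hne r le_rfl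
    rw [← hr, hfin] at this
    omega
  · intro h
    by_contra! h2
    have := finrank_ker_pow_le f ((minpoly ℂ A).rootMultiplicity z)
    rw [hfin] at this
    have := Nat.mul_le_mul_left ((minpoly ℂ A).rootMultiplicity z)
      (Nat.le_of_lt_succ h2)
    omega

end KerDim

/-! ### A real vector with the full minimal polynomial -/

section CyclicVector

variable {n : ℕ}

/-- Finitely many polynomials that do not annihilate `A` can be avoided by a real vector. -/
lemma exists_real_forall_aeval_mulVec_ne_zero (A : Matrix (Fin n) (Fin n) ℂ) (s : Finset ℂ[X])
    (hs : ∀ q ∈ s, aeval A q ≠ 0) :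
    ∃ v : Fin n → ℝ, ∀ q ∈ s, aeval A q *ᵥ (fun i => (v i : ℂ)) ≠ 0 := by
  classical
  let φ : (Fin n → ℝ) →ₗ[ℝ] (Fin n → ℂ) :=
    { toFun := fun v i => (v i : ℂ)
      map_add' := fun x y => by ext; simp
      map_smul' := fun c x => by ext; simp }
  let W : ℂ[X] → Submodule ℝ (Fin n → ℝ) := fun q =>
    LinearMap.ker ((Matrix.toLin' (aeval A q)).restrictScalars ℝ ∘ₗ φ)
  have hW : ∀ q v, v ∈ W q ↔ aeval A q *ᵥ (fun i => (v i : ℂ)) = 0 := fun q v => by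
    simp only [W, LinearMap.mem_ker, LinearMap.comp_apply, LinearMap.restrictScalars_apply,
      Matrix.toLin'_apply]
    rfl
  have htop : (⊤ : Submodule ℝ (Fin n → ℝ)) ∉ s.image W := by
    intro h
    obtain ⟨q, hq, hqt⟩ := Finset.mem_image.1 h
    refine hs q hq (Matrix.ext fun i j => ?_)
    have h1 : Pi.single j (1 : ℝ) ∈ W q := hqt ▸ Submodule.mem_top
    rw [hW] at h1
    have h2 : (fun i => ((Pi.single j (1 : ℝ) : Fin n → ℝ) i : ℂ)) = Pi.single j 1 := by
      ext i; by_cases h : i = j <;> simp [h]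
    rw [h2, Matrix.mulVec_single_one] at h1
    simpa using congrFun h1 i
  -- A vector space over the infinite field `ℝ` is not a finite union of proper subspaces.
  obtain ⟨v, hv⟩ := (Set.ne_univ_iff_exists_notMem _).1
    (Subspace.biUnion_ne_univ_of_top_notMem htop)
  refine ⟨v, fun q hq h0 => hv ?_⟩
  simp only [Set.mem_iUnion]
  exact ⟨W q, Finset.mem_image_of_mem W hq, (hW q v).2 h0⟩

/-- A proper monic divisor of `minpoly` divides `minpoly / (X - z)` for some root `z`. It is enough
that `v` avoids the kernels of these finitely many polynomials in `A`. -/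
lemma exists_isRealVec_isVecMinpoly_minpoly (A : Matrix (Fin n) (Fin n) ℂ) :
    ∃ v : Fin n → ℂ, IsRealVec v ∧ IsVecMinpoly A v (minpoly ℂ A) := by
  classical
  have hm : minpoly ℂ A ≠ 0 := minpoly.ne_zero (Matrix.isIntegral A)
  set q : ℂ → ℂ[X] := fun z => minpoly ℂ A /ₘ (X - C z) with hq
  have hmul : ∀ z ∈ (minpoly ℂ A).roots.toFinset, (X - C z) * q z = minpoly ℂ A := fun z hz =>
    mul_divByMonic_eq_iff_isRoot.2 (isRoot_of_mem_roots (Multiset.mem_toFinset.1 hz))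
  obtain ⟨v, hv⟩ := exists_real_forall_aeval_mulVec_ne_zero A
    ((minpoly ℂ A).roots.toFinset.image q) (by
      intro r hr h0
      obtain ⟨z, hz, rfl⟩ := Finset.mem_image.1 hr
      have h1 := minpoly.dvd ℂ A h0
      have h2 := hmul z hz
      have hq0 : q z ≠ 0 := fun h => hm (by rw [← h2, h, mul_zero])
      have h3 : (X - C z) * q z ∣ 1 * q z := by rwa [one_mul, h2]
      exact (prime_X_sub_C z).not_isUnit
        (isUnit_of_dvd_one ((mul_dvd_mul_iff_right hq0).1 h3)))
  refine ⟨fun i => (v i : ℂ), fun i => Complex.ofReal_im _, ?_⟩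
  obtain ⟨p, hp⟩ := exists_isVecMinpoly A (fun i => (v i : ℂ))
  suffices p = minpoly ℂ A from this ▸ hp
  obtain ⟨r, hr⟩ := hp.dvd_minpoly
  have hr0 : r ≠ 0 := by rintro rfl; exact hm (by rw [hr, mul_zero])
  have hrm : r.Monic := Monic.of_mul_monic_left hp.1 (hr ▸ minpoly.monic (Matrix.isIntegral A))
  by_cases hdeg : r.degree = 0
  · rw [hr, Polynomial.eq_one_of_monic_natDegree_zero hrm (natDegree_eq_of_degree_eq_some hdeg), mul_one]
  · exfalso
    obtain ⟨z, hz⟩ := IsAlgClosed.exists_root r hdeg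
    have hzm : z ∈ (minpoly ℂ A).roots.toFinset := by
      rw [Multiset.mem_toFinset, mem_roots hm, hr]
      exact root_mul_left_of_isRoot p hz
    refine hv (q z) (Finset.mem_image_of_mem q hzm) ((hp.aeval_mulVec_eq_zero_iff _).2 ?_)
    obtain ⟨r', hr'⟩ := dvd_iff_isRoot.2 hz
    refine ⟨r', mul_left_cancel₀ (X_sub_C_ne_zero z) ?_⟩
    rw [hmul z hzm, hr, hr']
    ring

end CyclicVector

/-! ### From the polynomial identity to spectrum and root dimensions -/

section Placement

variable {n : ℕ} {A B : Matrix (Fin n) (Fin n) ℂ} {v : Fin n → ℂ} {p : ℂ[X]}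

lemma mem_spectrum_iff_rootMultiplicity_pos (A : Matrix (Fin n) (Fin n) ℂ) (z : ℂ) :
    z ∈ spectrum ℂ A ↔ 0 < A.charpoly.rootMultiplicity z := by
  rw [Matrix.mem_spectrum_iff_isRoot_charpoly, rootMultiplicity_pos A.charpoly_monic.ne_zero]

lemma sum_spectrum_rootMultiplicity (hp : p ∣ A.charpoly) :
    ∑ z ∈ (Matrix.finite_spectrum A).toFinset, p.rootMultiplicity z = p.natDegree := by
  classical
  have hp0 : p ≠ 0 := ne_zero_of_dvd_ne_zero A.charpoly_monic.ne_zero hp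
  simp only [← count_roots]
  rw [Multiset.sum_count_eq_card, ← splits_iff_card_roots]
  · exact IsAlgClosed.splits p
  · intro z hz
    rw [Set.Finite.mem_toFinset, Matrix.mem_spectrum_iff_isRoot_charpoly]
    exact (isRoot_of_mem_roots hz).dvd hp

namespace IsVecMinpoly

lemma totalPoleOrder_eq (h : IsVecMinpoly A v p) : totalPoleOrder A 0 v = p.natDegree := by
  rw [totalPoleOrder, ← sum_spectrum_rootMultiplicity h.dvd_charpoly]
  exact Finset.sum_congr rfl fun z _ => h.resolventPoleOrder_eq z

end IsVecMinpoly

/-- The monic polynomial with roots `μ i` of multiplicities `m i`. -/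
noncomputable def rootsPoly {l : ℕ} (μ : Fin l → ℂ) (m : Fin l → ℕ) : ℂ[X] :=
  ∏ i, (X - C (μ i)) ^ m i

variable {l : ℕ} {μ : Fin l → ℂ} {m : Fin l → ℕ}

lemma monic_rootsPoly (μ : Fin l → ℂ) (m : Fin l → ℕ) : (rootsPoly μ m).Monic :=
  monic_prod_of_monic _ _ fun _ _ => (monic_X_sub_C _).pow _

lemma natDegree_rootsPoly (μ : Fin l → ℂ) (m : Fin l → ℕ) :
    (rootsPoly μ m).natDegree = ∑ i, m i := by
  rw [rootsPoly, natDegree_prod_of_monic _ _ fun _ _ => (monic_X_sub_C _).pow _]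
  exact Finset.sum_congr rfl fun i _ => by simp

lemma rootMultiplicity_rootsPoly (μ : Fin l → ℂ) (m : Fin l → ℕ) (z : ℂ) :
    (rootsPoly μ m).rootMultiplicity z = ∑ i, if z = μ i then m i else 0 := by
  classical
  have h0 : rootsPoly μ m ≠ 0 := (monic_rootsPoly μ m).ne_zero
  rw [← count_roots, rootsPoly, roots_prod _ _ h0, Multiset.count_bind]
  refine Finset.sum_congr rfl fun i _ => ?_
  simp [roots_pow, Multiset.count_singleton]

lemma rootMultiplicity_rootsPoly_apply (hμ : Function.Injective μ) (i : Fin l) :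
    (rootsPoly μ m).rootMultiplicity (μ i) = m i := by
  rw [rootMultiplicity_rootsPoly, Finset.sum_eq_single i]
  · simp
  · intro j _ hj
    rw [if_neg fun h => hj (hμ h).symm]
  · simp

lemma rootMultiplicity_rootsPoly_of_notMem {z : ℂ} (hz : z ∉ Set.range μ) :
    (rootsPoly μ m).rootMultiplicity z = 0 := by
  rw [rootMultiplicity_rootsPoly]
  exact Finset.sum_eq_zero fun i _ => if_neg fun h => hz ⟨i, h.symm⟩

lemma map_conj_rootsPoly (hμ : Function.Injective μ) (hs : ConjSymmetric μ m) :
    (rootsPoly μ m).map (starRingEnd ℂ) = rootsPoly μ m := by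
  choose σ hσ hσm using hs
  -- Conjugation permutes the indices, so it only reorders the product.
  have hinj : Function.Injective σ := fun i j hij => hμ (star_injective (by
    rw [← hσ, ← hσ, hij]))
  have hbij : Function.Bijective σ := Finite.injective_iff_bijective.1 hinj
  rw [rootsPoly, Polynomial.map_prod, ← hbij.prod_comp (fun i => (X - C (μ i)) ^ m i)]
  refine Finset.prod_congr rfl fun i _ => ?_
  rw [Polynomial.map_pow, Polynomial.map_sub, map_X, map_C, hσ, hσm]
  rfl

namespace IsVecMinpoly

/-- Multiplicities at `z` satisfy `p + B.charpoly = A.charpoly + rootsPoly` and `p ≤ minpoly ≤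
A.charpoly`. Off the `μ i`, `z` survives in the spectrum iff one of these two inequalities is
strict, which gives the two alternatives. -/
lemma spectrum_and_rootDimFormula (h : IsVecMinpoly A v p) (hμ : Function.Injective μ)
    (hm : ∀ i, 0 < m i) (hB : p * B.charpoly = A.charpoly * rootsPoly μ m) :
    spectrum ℂ B = Set.range μ ∪ {z | z ∈ spectrum ℂ A ∧
        (2 ≤ kerDim A z ∨ resolventPoleOrder A 0 v z < longestChain A z)} ∧
      RootDimFormula A B 0 v μ m := by
  have hmul : ∀ z, p.rootMultiplicity z + B.charpoly.rootMultiplicity z =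
      A.charpoly.rootMultiplicity z + (rootsPoly μ m).rootMultiplicity z := fun z => by
    rw [← rootMultiplicity_mul (mul_ne_zero h.1.ne_zero B.charpoly_monic.ne_zero), hB,
      rootMultiplicity_mul
        (mul_ne_zero A.charpoly_monic.ne_zero (monic_rootsPoly μ m).ne_zero)]
  have hle : ∀ z, p.rootMultiplicity z ≤ (minpoly ℂ A).rootMultiplicity z := fun z =>
    rootMultiplicity_le_rootMultiplicity_of_dvd
      (minpoly.ne_zero (Matrix.isIntegral A)) h.dvd_minpoly z
  have hle' : ∀ z, (minpoly ℂ A).rootMultiplicity z ≤ A.charpoly.rootMultiplicity z := fun z =>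
    rootMultiplicity_minpoly_le
  constructor
  · ext z
    rw [mem_spectrum_iff_rootMultiplicity_pos]
    by_cases hz : z ∈ Set.range μ
    · refine iff_of_true ?_ (Or.inl hz)
      obtain ⟨i, rfl⟩ := hz
      have h1 := hmul (μ i)
      rw [rootMultiplicity_rootsPoly_apply hμ] at h1
      have := hm i
      have := hle (μ i)
      have := hle' (μ i)
      omega
    · have h1 := hmul z
      rw [rootMultiplicity_rootsPoly_of_notMem hz] at h1
      have h2 := hle z
      have h3 := hle' z
      simp only [Set.mem_union, hz, false_or, Set.mem_ofPred_eq]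
      rw [h.resolventPoleOrder_eq, longestChain_eq_rootMultiplicity]
      constructor
      · intro h4
        have hzA : z ∈ spectrum ℂ A := by
          rw [mem_spectrum_iff_rootMultiplicity_pos]; omega
        refine ⟨hzA, ?_⟩
        rw [two_le_kerDim_iff hzA]
        omega
      · rintro ⟨hzA, h4⟩
        rw [two_le_kerDim_iff hzA] at h4
        omega
  · have hA0 : ∀ z, z ∉ spectrum ℂ A → A.charpoly.rootMultiplicity z = 0 := fun z hz => by
      rw [mem_spectrum_iff_rootMultiplicity_pos] at hz; omega
    simp only [RootDimFormula, rootDim_eq_rootMultiplicity, h.resolventPoleOrder_eq]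
    refine ⟨fun i _ => ?_, fun z _ hz => ?_, fun i hi => ?_, fun z hzA hz => ?_⟩
    · have h1 := hmul (μ i)
      rw [rootMultiplicity_rootsPoly_apply hμ] at h1
      omega
    · have h1 := hmul z
      rw [rootMultiplicity_rootsPoly_of_notMem hz] at h1
      omega
    · have h1 := hmul (μ i)
      rw [rootMultiplicity_rootsPoly_apply hμ] at h1
      have := hA0 _ hi
      have := hle (μ i)
      have := hle' (μ i)
      omega
    · have h1 := hmul z
      rw [rootMultiplicity_rootsPoly_of_notMem hz] at h1
      have := hA0 _ hzA
      omega

end IsVecMinpoly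

end Placement

/-! ### Real data -/

section Real

variable {n : ℕ} {A : Matrix (Fin n) (Fin n) ℂ} {v : Fin n → ℂ} {p : ℂ[X]}

lemma IsRealMat.map_conj (hA : IsRealMat A) : A.map (starRingEnd ℂ) = A :=
  Matrix.ext fun i j => Complex.conj_eq_iff_im.2 (hA i j)

lemma IsRealVec.star_eq (hv : IsRealVec v) : star v = v :=
  funext fun i => Complex.conj_eq_iff_im.2 (hv i)

lemma map_conj_aeval (A : Matrix (Fin n) (Fin n) ℂ) (q : ℂ[X]) :
    (aeval A q).map (starRingEnd ℂ) = aeval (A.map (starRingEnd ℂ)) (q.map (starRingEnd ℂ)) := by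
  have h : (starRingEnd ℂ).mapMatrix.comp (algebraMap ℂ (Matrix (Fin n) (Fin n) ℂ)) =
      (algebraMap ℂ (Matrix (Fin n) (Fin n) ℂ)).comp (starRingEnd ℂ) := by
    ext c i j
    by_cases hij : i = j <;> simp [Matrix.algebraMap_matrix_apply, hij]
  rw [← RingHom.mapMatrix_apply, aeval_def, hom_eval₂, h, aeval_def, eval₂_map]
  rfl

namespace IsVecMinpoly

/-- The conjugate of `p` also annihilates `v`, so `p` divides it; both are monic of the same degree.
-/
lemma map_conj (h : IsVecMinpoly A v p) (hA : IsRealMat A) (hv : IsRealVec v) :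
    p.map (starRingEnd ℂ) = p := by
  have h1 : aeval A (p.map (starRingEnd ℂ)) *ᵥ v = 0 := by
    have h2 := congrArg star h.2.1
    rw [star_zero] at h2
    rw [← h2]
    have h3 := map_conj_aeval A p
    rw [hA.map_conj] at h3
    rw [← h3]
    ext i
    simp only [Matrix.mulVec, dotProduct, Matrix.map_apply, Pi.star_apply, star_sum, star_mul']
    refine Finset.sum_congr rfl fun j _ => ?_
    rw [← Pi.star_apply v, hv.star_eq]
    rfl
  exact (eq_of_monic_of_dvd_of_natDegree_le h.1 (h.1.map _) (h.2.2 _ h1)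
    (natDegree_map_le)).symm ▸ rfl

lemma exists_real_mul_charpoly_add_vecMulVec (h : IsVecMinpoly A v p) (hA : IsRealMat A)
    (hv : IsRealVec v) {t : ℂ[X]} (ht : t.Monic) (hd : t.natDegree = p.natDegree)
    (hreal : t.map (starRingEnd ℂ) = t) :
    ∃ a, IsRealVec a ∧ p * (A + vecMulVec v a).charpoly = A.charpoly * t := by
  obtain ⟨a, ha⟩ := h.exists_mul_charpoly_add_vecMulVec ht hd
  have hb : p * (A + vecMulVec v (star a)).charpoly = A.charpoly * t := by
    have h1 := congrArg (Polynomial.map (starRingEnd ℂ)) ha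
    rw [Polynomial.map_mul, Polynomial.map_mul, ← Matrix.charpoly_map, ← Matrix.charpoly_map,
      h.map_conj hA hv, hreal, hA.map_conj] at h1
    rw [← h1]
    congr 2
    rw [Matrix.map_add _ (map_add _), hA.map_conj]
    congr 1
    ext i j
    have h3 : starRingEnd ℂ (v i) = v i := congrFun hv.star_eq i
    simp [vecMulVec_apply, h3]
  -- The condition on `a` is affine by `mul_charpoly_add_vecMulVec`, so the midpoint of two
  -- solutions is a solution.
  refine ⟨(1 / 2 : ℂ) • (a + star a), fun i => ?_, ?_⟩
  · simp
  · rw [h.mul_charpoly_add_vecMulVec] at ha hb ⊢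
    have h1 : ∑ k ∈ Finset.range p.natDegree,
          C (((1 / 2 : ℂ) • (a + star a)) ⬝ᵥ resolventCoeff A v p k) * X ^ k =
        C (1 / 2 : ℂ) * (∑ k ∈ Finset.range p.natDegree,
            C (a ⬝ᵥ resolventCoeff A v p k) * X ^ k +
          ∑ k ∈ Finset.range p.natDegree, C (star a ⬝ᵥ resolventCoeff A v p k) * X ^ k) := by
      rw [← Finset.sum_add_distrib, Finset.mul_sum]
      refine Finset.sum_congr rfl fun k _ => ?_
      rw [smul_dotProduct, add_dotProduct, smul_eq_mul, C_mul, C_add]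
      ring
    have h2 : (C (1 / 2 : ℂ)) + C (1 / 2 : ℂ) = 1 := by
      rw [← C_add, add_halves, C_1]
    rw [h1]
    linear_combination C (1 / 2 : ℂ) * ha + C (1 / 2 : ℂ) * hb +
      (A.charpoly * t - A.charpoly * p) * h2

end IsVecMinpoly

end Real

/-! ### Assembly -/

theorem exists_rank_one_placement (n : ℕ) (A : Matrix (Fin n) (Fin n) ℂ) (v : Fin n → ℂ) (l : ℕ)
    (μ : Fin l → ℂ) (m : Fin l → ℕ) (hμ : Function.Injective μ) (hm : ∀ i, 0 < m i)
    (hsum : ∑ i, m i = totalPoleOrder A 0 v) :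
    (∃ w : Fin n → ℂ,
      spectrum ℂ (A + Matrix.vecMulVec v (star w)) =
        Set.range μ ∪
          {z | z ∈ spectrum ℂ A ∧
            (2 ≤ kerDim A z ∨ resolventPoleOrder A 0 v z < longestChain A z)} ∧
      RootDimFormula A (A + Matrix.vecMulVec v (star w)) 0 v μ m) ∧
    (IsRealMat A → IsRealVec v → ConjSymmetric μ m →
      ∃ w : Fin n → ℂ, IsRealVec w ∧
        spectrum ℂ (A + Matrix.vecMulVec v (star w)) =
          Set.range μ ∪
            {z | z ∈ spectrum ℂ A ∧
              (2 ≤ kerDim A z ∨ resolventPoleOrder A 0 v z < longestChain A z)} ∧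
        RootDimFormula A (A + Matrix.vecMulVec v (star w)) 0 v μ m) := by
  obtain ⟨p, hp⟩ := exists_isVecMinpoly A v
  have hd : (rootsPoly μ m).natDegree = p.natDegree := by
    rw [natDegree_rootsPoly, hsum, hp.totalPoleOrder_eq]
  constructor
  · obtain ⟨a, ha⟩ := hp.exists_mul_charpoly_add_vecMulVec (monic_rootsPoly μ m) hd
    -- The perturbation is `v w*`, while `a` enters unconjugated.
    refine ⟨star a, ?_⟩
    rw [star_star]
    exact hp.spectrum_and_rootDimFormula hμ hm ha
  · intro hA hv hs
    obtain ⟨a, hreal, ha⟩ := hp.exists_real_mul_charpoly_add_vecMulVec hA hv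
      (monic_rootsPoly μ m) hd (map_conj_rootsPoly hμ hs)
    refine ⟨a, hreal, ?_⟩
    rw [hreal.star_eq]
    exact hp.spectrum_and_rootDimFormula hμ hm ha

theorem corollary6p4 (n : ℕ) (A : Matrix (Fin n) (Fin n) ℂ) :
    -- placement for a fixed vector `v`, with the real version
    (∀ (v : Fin n → ℂ) (l : ℕ) (μ : Fin l → ℂ) (m : Fin l → ℕ),
      Function.Injective μ → (∀ i, 0 < m i) → ∑ i, m i = totalPoleOrder A 0 v →
      (∃ w : Fin n → ℂ,
        spectrum ℂ (A + Matrix.vecMulVec v (star w)) =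
          Set.range μ ∪
            {z | z ∈ spectrum ℂ A ∧
              (2 ≤ kerDim A z ∨ resolventPoleOrder A 0 v z < longestChain A z)} ∧
        RootDimFormula A (A + Matrix.vecMulVec v (star w)) 0 v μ m) ∧
      (IsRealMat A → IsRealVec v → ConjSymmetric μ m →
        ∃ w : Fin n → ℂ, IsRealVec w ∧
          spectrum ℂ (A + Matrix.vecMulVec v (star w)) =
            Set.range μ ∪
              {z | z ∈ spectrum ℂ A ∧
                (2 ≤ kerDim A z ∨ resolventPoleOrder A 0 v z < longestChain A z)} ∧
          RootDimFormula A (A + Matrix.vecMulVec v (star w)) 0 v μ m)) ∧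
    -- a suitable `v` exists, and it can be chosen real for real `A`
    (∃ v : Fin n → ℂ, ∀ z ∈ spectrum ℂ A, resolventPoleOrder A 0 v z = longestChain A z) ∧
    (IsRealMat A → ∃ v : Fin n → ℂ, IsRealVec v ∧
      ∀ z ∈ spectrum ℂ A, resolventPoleOrder A 0 v z = longestChain A z) ∧
    -- what holds for every such `v`
    (∀ v : Fin n → ℂ,
      (∀ z ∈ spectrum ℂ A, resolventPoleOrder A 0 v z = longestChain A z) →
      totalPoleOrder A 0 v = (minpoly ℂ A).natDegree ∧
      ∀ (l : ℕ) (μ : Fin l → ℂ) (m : Fin l → ℕ),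
        Function.Injective μ → (∀ i, 0 < m i) → ∑ i, m i = (minpoly ℂ A).natDegree →
        (∃ w : Fin n → ℂ,
          spectrum ℂ (A + Matrix.vecMulVec v (star w)) =
            Set.range μ ∪ {z | z ∈ spectrum ℂ A ∧ 2 ≤ kerDim A z} ∧
          RootDimFormula A (A + Matrix.vecMulVec v (star w)) 0 v μ m) ∧
        (IsRealMat A → IsRealVec v → ConjSymmetric μ m →
          ∃ w : Fin n → ℂ, IsRealVec w ∧
            spectrum ℂ (A + Matrix.vecMulVec v (star w)) =
              Set.range μ ∪ {z | z ∈ spectrum ℂ A ∧ 2 ≤ kerDim A z} ∧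
            RootDimFormula A (A + Matrix.vecMulVec v (star w)) 0 v μ m)) := by
  have hex : ∃ v : Fin n → ℂ, IsRealVec v ∧
      ∀ z ∈ spectrum ℂ A, resolventPoleOrder A 0 v z = longestChain A z := by
    obtain ⟨v, hv, hp⟩ := exists_isRealVec_isVecMinpoly_minpoly A
    exact ⟨v, hv, fun z _ => by
      rw [hp.resolventPoleOrder_eq, longestChain_eq_rootMultiplicity]⟩
  refine ⟨fun v l μ m => exists_rank_one_placement n A v l μ m, hex.imp fun v h => h.2, fun _ => hex,
    fun v hv => ?_⟩
  have htotal : totalPoleOrder A 0 v = (minpoly ℂ A).natDegree := by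
    rw [totalPoleOrder, ← sum_spectrum_rootMultiplicity (Matrix.minpoly_dvd_charpoly A)]
    refine Finset.sum_congr rfl fun z hz => ?_
    rw [hv z ((Set.Finite.mem_toFinset _).1 hz), longestChain_eq_rootMultiplicity]
  refine ⟨htotal, fun l μ m hμ hm hsum => ?_⟩
  -- Equality of pole order and chain length rules out the second alternative.
  have hset : {z | z ∈ spectrum ℂ A ∧
      (2 ≤ kerDim A z ∨ resolventPoleOrder A 0 v z < longestChain A z)} =
      {z | z ∈ spectrum ℂ A ∧ 2 ≤ kerDim A z} := by
    ext z
    refine and_congr_right fun hz => ?_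
    rw [hv z hz]
    simp
  have h := exists_rank_one_placement n A v l μ m hμ hm (hsum.trans htotal.symm)
  rwa [hset] at h
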